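/- Let $d\in\mathbb N$, $\kappa>0$, and let $V\in C^2(\mathbb R^d)$ satisfy $\mu\,\mathbb I\preccurlyeq D^2V(x)\preccurlyeq L\,\mathbb I$ for all $x\in\mathbb R^d$, with constants $0<\mu\le L<\infty$. Let $$p(x):=\operatorname*{argmin}_{y\in\mathbb R^d}\ \frac{|x-y|^2}{2\kappa^2}+V(y)$$ be the proximal operator of $\kappa^2V$, and for a Borel probability measure $\rho$ on $\mathbb R^d$ put $$\mathcal L[\rho]:=\frac12\int|x-p(x)|^2\,d\rho(x)\in[0,\infty].$$ For $\sigma\ge0$, a weak solution of $$\partial_t\rho_t=\operatorname{div}\big(\rho_t\,(x-p(x))\big)+\frac{\sigma^2}{2}\Delta\big(\rho_t\,|x-p(x)|^2\big)\qquad(\ast)$$ is a weakly continuous curve $[0,\infty)\ni t\mapsto\rho_t$ of Borel probability measures on $\mathbb R^d$ such that for all $\phi\in C_c^\infty(\mathbb R^d)$ and all $t>0$ $$\frac{d}{dt}\int\phi\,d\rho_t=-\int\nabla\phi(x)\cdot(x-p(x))\,d\rho_t(x)+\frac{\sigma^2}{2}\int\Delta\phi(x)\,|x-p(x)|^2\,d\rho_t(x).$$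 Then $V$ has a unique global minimizer $x^*=\operatorname{argmin}V$, and there is a constant $C_1>0$, depending only on $V$ and $\kappa$ (and $d$), such that the following holds for every $0\le\sigma<C_1$. If $\sigma>0$, assume in addition that $V\in C^3(\mathbb R^d)$ and $\sup_{x\in\mathbb R^d}|DV(x)|\,|D^3V(x)|<\infty$. Then every weak solution $(\rho_t)_{t\ge0}$ of $(\ast)$ with $\mathcal L[\rho_0]<\infty$ satisfies $$W_2(\rho_t,\delta_{x^*})\to0\qquad\text{as }t\to\infty,$$ where $W_2$ is the Wasserstein-2 distance. -/

import Mathlib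

open Set Filter Topology MeasureTheory
open scoped ENNReal ContDiff

noncomputable section

/-- The space `ℝ^d` with its Euclidean norm. -/
abbrev Rd (d : ℕ) : Type := EuclideanSpace ℝ (Fin d)

variable {d : ℕ}

/-- A global minimizer of `f` (an arbitrary point if there is none). -/
def argmin (f : Rd d → ℝ) : Rd d :=
  Classical.epsilon fun y => ∀ z, f y ≤ f z

/-- `argmin f` is the minimizer of `f` whenever `f` has a unique global minimizer. -/
theorem argmin_eq_of_strict {f : Rd d → ℝ} {y : Rd d} (hy : ∀ z, z ≠ y → f y < f z) :
    argmin f = y := by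
  have hmin : ∀ z, f y ≤ f z := fun z => by
    by_cases h : z = y
    · rw [h]
    · exact (hy z h).le
  have hspec : ∀ z, f (argmin f) ≤ f z :=
    Classical.epsilon_spec (p := fun y => ∀ z, f y ≤ f z) ⟨y, hmin⟩
  by_contra h
  exact absurd (hspec y) (not_le.mpr (hy _ h))

/-- The proximal operator of `κ² V`: `p(x) = argmin_y |x - y|² / (2 κ²) + V(y)`. -/
def prox (κ : ℝ) (V : Rd d → ℝ) (x : Rd d) : Rd d :=
  argmin fun y => ‖x - y‖ ^ 2 / (2 * κ ^ 2) + V y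

/-- The Lyapunov functional `½ ∫ |x - p(x)|² dρ(x)`, with values in `[0, ∞]`. -/
def lyapunov (κ : ℝ) (V : Rd d → ℝ) (ρ : ProbabilityMeasure (Rd d)) : ℝ≥0∞ :=
  (1 / 2) * ∫⁻ x, ‖x - prox κ V x‖ₑ ^ 2 ∂(ρ : Measure (Rd d))

/-- Weak solutions, on the time interval `[0, ∞)`, of
`∂ₜ ρₜ = div (ρₜ (x - p(x))) + (σ² / 2) Δ (ρₜ |x - p(x)|²)`,
where `p` is the proximal operator of `κ² V`. They are curves of probability measures that are
continuous for weak convergence of measures and satisfy the equation tested against every smooth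
compactly supported function. -/
structure IsWeakSolution (σ κ : ℝ) (V : Rd d → ℝ) (ρ : ℝ → ProbabilityMeasure (Rd d)) : Prop where
  continuousOn : ContinuousOn ρ (Ici 0)
  hasDerivAt : ∀ φ : Rd d → ℝ, ContDiff ℝ ∞ φ → HasCompactSupport φ → ∀ t : ℝ, 0 < t →
    HasDerivAt (fun s => ∫ x, φ x ∂(ρ s : Measure (Rd d)))
      (-(∫ x, inner ℝ (gradient φ x) (x - prox κ V x) ∂(ρ t : Measure (Rd d)))
        + σ ^ 2 / 2 *
          ∫ x, Laplacian.laplacian φ x * ‖x - prox κ V x‖ ^ 2 ∂(ρ t : Measure (Rd d))) t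

/-- Couplings of `μ` and `ν`: measures on the product whose marginals are `μ` and `ν`. -/
def IsCoupling (μ ν : ProbabilityMeasure (Rd d)) (π : Measure (Rd d × Rd d)) : Prop :=
  π.map Prod.fst = (μ : Measure (Rd d)) ∧ π.map Prod.snd = (ν : Measure (Rd d))

/-- The Wasserstein-2 distance, with values in `[0, ∞]`. -/
def W2 (μ ν : ProbabilityMeasure (Rd d)) : ℝ≥0∞ :=
  (⨅ (π : Measure (Rd d × Rd d)) (_ : IsCoupling μ ν π), ∫⁻ z, edist z.1 z.2 ^ 2 ∂π) ^ (1 / 2 : ℝ)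

/-- The Dirac measure at `a`. -/
def diracProb (a : Rd d) : ProbabilityMeasure (Rd d) :=
  ⟨Measure.dirac a, inferInstance⟩

end

/-! The Lyapunov function that works is the second moment about `a = argmin V`. Write `b = x -
p(x)`. Testing the equation formally with `|x - a|²` gives the rate `∫ (-2⟨x - a, b⟩ + σ² d |b|²)
dρ`. Optimality of `p(x)` reads `b = κ² ∇V(p(x))`, so strong monotonicity of `∇V` yields both `|b|²
≤ ⟨x - a, b⟩` (`sq_norm_sub_prox_le`) and `|x - a|² ≤ C ⟨x - a, b⟩` (`sq_norm_sub_argmin_le`). If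
`σ² d ≤ 1`, half of the drift absorbs the noise and the rate is at most `-C⁻¹ ∫ |x - a|² dρ`. A
nonincreasing quantity with this dissipation is at most `C M / T` at time `T`, where `M` is its
initial value; `M` is finite because `|x - a| ≤ C |b|`.

Test functions must have compact support, so `|x - a|²` is replaced by a concave truncation
`truncation R`, constant far out. Concavity gives the extra Laplacian term a favourable sign. The
dissipation at level `R` controls the moment at a fixed level `S` up to `O(S / R)`
(`truncation_sub_le`). Letting `R → ∞` and then `S → ∞` gives the decay of the full second moment,
which bounds `W2` to the Dirac mass. -/

/-! ### Strong convexity and minimizers -/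

/-- A differentiable function whose derivative is `m`-strongly monotone lies above its tangent
parabolas of curvature `m`. -/
theorem tangent_parabola_le {d : ℕ} {f : Rd d → ℝ} {m : ℝ} (hf : Differentiable ℝ f)
    (hmono : ∀ y z, m * ‖z - y‖ ^ 2 ≤ fderiv ℝ f z (z - y) - fderiv ℝ f y (z - y)) (y z : Rd d) :
    f y + fderiv ℝ f y (z - y) + m / 2 * ‖z - y‖ ^ 2 ≤ f z := by
  set v := z - y with hv
  -- `k` is `f` minus its tangent parabola along the segment, up to a constant; it is nondecreasing
  -- on `[0, 1]`.
  let k : ℝ → ℝ := fun t => f (y + t • v) - fderiv ℝ f y v * t - m / 2 * ‖v‖ ^ 2 * t ^ 2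
  have hline (t : ℝ) : HasDerivAt (fun t : ℝ => y + t • v) v t := by
    simpa using ((hasDerivAt_id t).smul_const v).const_add y
  have hk (t : ℝ) : HasDerivAt k (fderiv ℝ f (y + t • v) v - fderiv ℝ f y v
      - m * ‖v‖ ^ 2 * t) t := by
    have h1 : HasDerivAt (fun t : ℝ => f (y + t • v)) (fderiv ℝ f (y + t • v) v) t :=
      (hf (y + t • v)).hasFDerivAt.comp_hasDerivAt t (hline t)
    refine ((h1.sub ((hasDerivAt_id t).const_mul (fderiv ℝ f y v))).sub
      ((hasDerivAt_pow 2 t).const_mul (m / 2 * ‖v‖ ^ 2))).congr_deriv ?_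
    push_cast; ring
  have hkmono : MonotoneOn k (Icc 0 1) := by
    refine monotoneOn_of_deriv_nonneg (convex_Icc 0 1)
      (fun t _ => (hk t).continuousAt.continuousWithinAt)
      (fun t _ => (hk t).differentiableAt.differentiableWithinAt) fun t ht => ?_
    rw [interior_Icc] at ht
    rw [(hk t).deriv]
    have h := hmono y (y + t • v)
    simp only [add_sub_cancel_left, map_smul, smul_eq_mul, norm_smul, mul_pow, Real.norm_eq_abs,
      sq_abs] at h
    have : t * (m * ‖v‖ ^ 2 * t) ≤ t * (fderiv ℝ f (y + t • v) v - fderiv ℝ f y v) := by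
      linarith
    have := le_of_mul_le_mul_left this ht.1
    linarith
  have := hkmono (left_mem_Icc.2 zero_le_one) (right_mem_Icc.2 zero_le_one) zero_le_one
  have hz : y + v = z := by simp [hv]
  simp only [k, zero_smul, one_smul, add_zero, hz] at this
  linarith

/-- A strongly convex differentiable function has a strict global minimizer. -/
theorem exists_strict_minimizer {d : ℕ} {f : Rd d → ℝ} {m : ℝ} (hm : 0 < m)
    (hf : Differentiable ℝ f)
    (hmono : ∀ y z, m * ‖z - y‖ ^ 2 ≤ fderiv ℝ f z (z - y) - fderiv ℝ f y (z - y)) :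
    ∃ y, ∀ z, z ≠ y → f y < f z := by
  have hbelow := tangent_parabola_le hf hmono
  have hcoer : Tendsto f (cocompact (Rd d)) atTop := by
    -- The tangent parabola at `0`, with its linear term bounded by the operator norm, as a function
    -- of `r = ‖z‖`.
    have h1 : Tendsto (fun r : ℝ => f 0 + r * (m / 2 * r + -‖fderiv ℝ f 0‖)) atTop atTop := by
      refine tendsto_atTop_add_const_left _ _ (tendsto_id.atTop_mul_atTop₀ ?_)
      exact tendsto_atTop_add_const_right _ _ (tendsto_id.const_mul_atTop (by positivity))
    refine tendsto_atTop_mono (fun z => ?_) (h1.comp (tendsto_norm_cocompact_atTop (E := Rd d)))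
    have h2 := hbelow 0 z
    have h3 := (abs_le.1 ((Real.norm_eq_abs _).symm.trans_le
      ((fderiv ℝ f 0).le_opNorm z))).1
    simp only [sub_zero] at h2
    simp only [Function.comp_apply]
    nlinarith
  obtain ⟨y, hy⟩ := hf.continuous.exists_forall_le hcoer
  refine ⟨y, fun z hz => ?_⟩
  have h0 : fderiv ℝ f y = 0 := IsLocalMin.fderiv_eq_zero (Eventually.of_forall hy)
  have h1 := hbelow y z
  have h2 : 0 < ‖z - y‖ := norm_pos_iff.2 (sub_ne_zero.2 hz)
  rw [h0] at h1
  simp only [zero_apply, add_zero] at h1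
  have : 0 < m / 2 * ‖z - y‖ ^ 2 := by positivity
  linarith

/-- A lower bound on the Hessian makes the derivative strongly monotone. -/
theorem fderiv_strongly_monotone {d : ℕ} {V : Rd d → ℝ} (hV : ContDiff ℝ 2 V) {μ : ℝ}
    (hlower : ∀ x v : Rd d, μ * ‖v‖ ^ 2 ≤ iteratedFDeriv ℝ 2 V x ![v, v]) (y z : Rd d) :
    μ * ‖z - y‖ ^ 2 ≤ fderiv ℝ V z (z - y) - fderiv ℝ V y (z - y) := by
  set v := z - y with hv
  have hD : Differentiable ℝ (fderiv ℝ V) :=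
    (hV.fderiv_right (m := 1) (by norm_num)).differentiable (by norm_num)
  have hline (t : ℝ) : HasDerivAt (fun t : ℝ => y + t • v) v t := by
    simpa using ((hasDerivAt_id t).smul_const v).const_add y
  have hk (t : ℝ) : HasDerivAt (fun t : ℝ => fderiv ℝ V (y + t • v) v)
      (fderiv ℝ (fderiv ℝ V) (y + t • v) v v) t := by
    have h1 := (hD (y + t • v)).hasFDerivAt.comp_hasDerivAt t (hline t)
    exact ((ContinuousLinearMap.apply ℝ ℝ v).hasFDerivAt.comp_hasDerivAt t h1).congr_deriv (by simp)
  obtain ⟨t, -, ht⟩ := exists_hasDerivAt_eq_slope _ _ (zero_lt_one (α := ℝ))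
    (fun t _ => (hk t).continuousAt.continuousWithinAt) (fun t _ => hk t)
  have hl := hlower (y + t • v) v
  rw [iteratedFDeriv_two_apply] at hl
  have hz : y + v = z := by simp [hv]
  simp only [Matrix.cons_val_zero, Matrix.cons_val_one] at hl
  simp only [zero_smul, one_smul, add_zero, hz, sub_zero, div_one] at ht
  linarith

theorem strict_argmin {d : ℕ} {f : Rd d → ℝ} (h : ∃ y, ∀ z, z ≠ y → f y < f z) (y : Rd d)
    (hy : y ≠ argmin f) : f (argmin f) < f y := by
  obtain ⟨x, hx⟩ := h
  rw [argmin_eq_of_strict hx] at hy ⊢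
  exact hx y hy

theorem fderiv_argmin {d : ℕ} {f : Rd d → ℝ} (h : ∃ y, ∀ z, z ≠ y → f y < f z) :
    fderiv ℝ f (argmin f) = 0 := by
  refine IsLocalMin.fderiv_eq_zero (Eventually.of_forall fun z => ?_)
  by_cases hz : z = argmin f
  · rw [hz]
  · exact (strict_argmin h z hz).le

/-! ### Coercivity of the proximal drift -/

section Prox

variable {d : ℕ} {κ : ℝ} {V : Rd d → ℝ} {μ : ℝ}

/-- The first-order optimality condition for the proximal operator. -/
theorem inner_sub_prox (hκ : 0 < κ) (hμ : 0 < μ) (hV : Differentiable ℝ V)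
    (hmono : ∀ y z, μ * ‖z - y‖ ^ 2 ≤ fderiv ℝ V z (z - y) - fderiv ℝ V y (z - y))
    (x v : Rd d) :
    inner ℝ (x - prox κ V x) v = κ ^ 2 * fderiv ℝ V (prox κ V x) v := by
  have hder (y : Rd d) : HasFDerivAt (fun y => ‖x - y‖ ^ 2 / (2 * κ ^ 2) + V y)
      ((-(1 / κ ^ 2)) • innerSL ℝ (x - y) + fderiv ℝ V y) y := by
    have h1 : HasFDerivAt (fun y : Rd d => ‖x - y‖ ^ 2) (-(2 • innerSL ℝ (x - y))) y := by
      refine ((hasFDerivAt_id y).const_sub x).norm_sq.congr_fderiv ?_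
      ext w; simp; ring
    refine ((h1.mul_const (2 * κ ^ 2)⁻¹).add (hV y).hasFDerivAt).congr_fderiv ?_
    ext w
    simp; ring
  have hex : ∃ y, ∀ z, z ≠ y → ‖x - y‖ ^ 2 / (2 * κ ^ 2) + V y
      < ‖x - z‖ ^ 2 / (2 * κ ^ 2) + V z := by
    refine exists_strict_minimizer (f := fun y => ‖x - y‖ ^ 2 / (2 * κ ^ 2) + V y) hμ
      (fun y => (hder y).differentiableAt) fun y z => ?_
    rw [(hder z).fderiv, (hder y).fderiv]
    have h2 : inner ℝ (x - y) (z - y) - inner ℝ (x - z) (z - y) = ‖z - y‖ ^ 2 := by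
      rw [← inner_sub_left, ← real_inner_self_eq_norm_sq]; congr 1; abel
    have h3 : 0 ≤ 1 / κ ^ 2 * (inner ℝ (x - y) (z - y) - inner ℝ (x - z) (z - y)) := by
      rw [h2]; positivity
    have := hmono y z
    simp only [add_apply, smul_apply, innerSL_apply_apply,
      smul_eq_mul]
    linarith
  have h0 := fderiv_argmin hex
  change fderiv ℝ _ (prox κ V x) = 0 at h0
  rw [(hder _).fderiv] at h0
  have h1 := DFunLike.congr_fun h0 v
  simp only [add_apply, smul_apply, innerSL_apply_apply,
      smul_eq_mul, zero_apply] at h1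
  have hκ2 : κ ^ 2 ≠ 0 := by positivity
  field_simp at h1
  linarith

/-- By `inner_sub_prox`, the drift is `κ²` times the gradient of `V` at the proximal point, so
strong monotonicity transfers to it. -/
theorem prox_strongly_monotone (hκ : 0 < κ) (hμ : 0 < μ) (hV : Differentiable ℝ V)
    (hmono : ∀ y z, μ * ‖z - y‖ ^ 2 ≤ fderiv ℝ V z (z - y) - fderiv ℝ V y (z - y))
    (x y : Rd d) :
    κ ^ 2 * μ * ‖prox κ V x - prox κ V y‖ ^ 2 ≤
      inner ℝ ((x - prox κ V x) - (y - prox κ V y)) (prox κ V x - prox κ V y) := by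
  rw [inner_sub_left, inner_sub_prox hκ hμ hV hmono, inner_sub_prox hκ hμ hV hmono, mul_assoc,
    ← mul_sub]
  exact mul_le_mul_of_nonneg_left (hmono _ _) (sq_nonneg κ)

theorem lipschitzWith_prox (hκ : 0 < κ) (hμ : 0 < μ) (hV : Differentiable ℝ V)
    (hmono : ∀ y z, μ * ‖z - y‖ ^ 2 ≤ fderiv ℝ V z (z - y) - fderiv ℝ V y (z - y)) : LipschitzWith 1 (prox κ V) := by
  refine LipschitzWith.mk_one fun x y => ?_
  rw [dist_eq_norm, dist_eq_norm]
  have h := prox_strongly_monotone hκ hμ hV hmono x y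
  have h0 : 0 ≤ κ ^ 2 * μ * ‖prox κ V x - prox κ V y‖ ^ 2 := by positivity
  have e : x - y = ((x - prox κ V x) - (y - prox κ V y)) + (prox κ V x - prox κ V y) := by abel
  refine le_of_sq_le_sq ?_ (norm_nonneg _)
  rw [e, norm_add_sq_real]
  nlinarith [sq_nonneg ‖(x - prox κ V x) - (y - prox κ V y)‖]

theorem prox_argmin (hmin : ∃ y, ∀ z, z ≠ y → V y < V z) : prox κ V (argmin V) = argmin V := by
  refine argmin_eq_of_strict fun z hz => ?_
  have h1 := strict_argmin hmin z hz
  have h2 : 0 ≤ ‖argmin V - z‖ ^ 2 / (2 * κ ^ 2) := by positivity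
  simp only [sub_self, norm_zero]
  linarith [show (0 : ℝ) ^ 2 / (2 * κ ^ 2) = 0 by simp]

/-- Split `x - a = b + q` with `b = x - p(x)` and `q = p(x) - a`. Since `a` is a fixed point of the
proximal map, monotonicity gives `⟨b, q⟩ ≥ 0`. -/
theorem sq_norm_sub_prox_le (hκ : 0 < κ) (hμ : 0 < μ) (hV : Differentiable ℝ V)
    (hmono : ∀ y z, μ * ‖z - y‖ ^ 2 ≤ fderiv ℝ V z (z - y) - fderiv ℝ V y (z - y))
    (hmin : ∃ y, ∀ z, z ≠ y → V y < V z) (x : Rd d) :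
    ‖x - prox κ V x‖ ^ 2 ≤ inner ℝ (x - argmin V) (x - prox κ V x) := by
  have h := prox_strongly_monotone hκ hμ hV hmono x (argmin V)
  have h0 : 0 ≤ κ ^ 2 * μ * ‖prox κ V x - prox κ V (argmin V)‖ ^ 2 := by positivity
  rw [prox_argmin (κ := κ) hmin, sub_self, sub_zero] at h
  rw [prox_argmin (κ := κ) hmin] at h0
  have e : x - argmin V = (x - prox κ V x) + (prox κ V x - argmin V) := by abel
  rw [e, inner_add_left, real_inner_self_eq_norm_sq, real_inner_comm]
  linarith

/-- In the same splitting, `|b + q|² ≤ 2|b|² + 2|q|²`; strong monotonicity bounds `|q|²` by `⟨b, q⟩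
/ (κ² μ)`, and `⟨x - a, b⟩ = |b|² + ⟨b, q⟩` with both terms nonnegative. -/
theorem sq_norm_sub_argmin_le (hκ : 0 < κ) (hμ : 0 < μ) (hV : Differentiable ℝ V)
    (hmono : ∀ y z, μ * ‖z - y‖ ^ 2 ≤ fderiv ℝ V z (z - y) - fderiv ℝ V y (z - y))
    (hmin : ∃ y, ∀ z, z ≠ y → V y < V z) (x : Rd d) :
    ‖x - argmin V‖ ^ 2 ≤ (2 / (κ ^ 2 * μ) + 2) * inner ℝ (x - argmin V) (x - prox κ V x) := by
  have h := prox_strongly_monotone hκ hμ hV hmono x (argmin V)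
  rw [prox_argmin (κ := κ) hmin, sub_self, sub_zero] at h
  have e : x - argmin V = (x - prox κ V x) + (prox κ V x - argmin V) := by abel
  set b := x - prox κ V x
  set q := prox κ V x - argmin V
  have hc : 0 < κ ^ 2 * μ := by positivity
  rw [e, inner_add_left, real_inner_self_eq_norm_sq, real_inner_comm]
  have h1 : ‖b + q‖ ^ 2 ≤ 2 * ‖b‖ ^ 2 + 2 * ‖q‖ ^ 2 := by
    have := parallelogram_law_with_norm ℝ b q
    nlinarith [sq_nonneg ‖b - q‖]
  have h2 : ‖q‖ ^ 2 ≤ 1 / (κ ^ 2 * μ) * inner ℝ b q := by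
    rw [one_div, ← div_eq_inv_mul, le_div_iff₀ hc]; linarith
  have h3 : 0 ≤ inner ℝ b q := le_trans (by positivity) h
  have h4 : 0 ≤ 1 / (κ ^ 2 * μ) * ‖b‖ ^ 2 := by positivity
  have e2 : 2 / (κ ^ 2 * μ) = 2 * (1 / (κ ^ 2 * μ)) := by ring
  rw [e2]
  nlinarith

end Prox

/-! ### Calculus of radial functions -/

section Radial

variable {d : ℕ} {h h₁ h₂ : ℝ → ℝ}

theorem hasFDerivAt_sq_norm_sub {d : ℕ} (a x : Rd d) :
    HasFDerivAt (fun x => ‖x - a‖ ^ 2) ((2 : ℝ) • innerSL ℝ (x - a)) x := by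
  refine ((hasFDerivAt_id x).sub_const a).norm_sq.congr_fderiv ?_
  ext w; simp

theorem hasFDerivAt_radial (hh : ∀ s, HasDerivAt h (h₁ s) s) (a : Rd d) (k : ℝ) (x : Rd d) :
    HasFDerivAt (fun x => h (‖x - a‖ ^ 2) - k) ((2 * h₁ (‖x - a‖ ^ 2)) • innerSL ℝ (x - a)) x := by
  refine (((hh _).comp_hasFDerivAt x (hasFDerivAt_sq_norm_sub a x)).sub_const k).congr_fderiv ?_
  rw [smul_smul, mul_comm]

theorem gradient_radial (hh : ∀ s, HasDerivAt h (h₁ s) s) (a : Rd d) (k : ℝ) (x : Rd d) :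
    gradient (fun x => h (‖x - a‖ ^ 2) - k) x = (2 * h₁ (‖x - a‖ ^ 2)) • (x - a) := by
  refine HasGradientAt.gradient ?_
  rw [hasGradientAt_iff_hasFDerivAt]
  refine (hasFDerivAt_radial hh a k x).congr_fderiv ?_
  ext w; simp

theorem laplacian_radial (hh : ∀ s, HasDerivAt h (h₁ s) s) (hh₁ : ∀ s, HasDerivAt h₁ (h₂ s) s)
    (a : Rd d) (k : ℝ) (x : Rd d) :
    Laplacian.laplacian (fun x => h (‖x - a‖ ^ 2) - k) x
      = 4 * h₂ (‖x - a‖ ^ 2) * ‖x - a‖ ^ 2 + 2 * d * h₁ (‖x - a‖ ^ 2) := by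
  have hD : fderiv ℝ (fun x => h (‖x - a‖ ^ 2) - k)
      = fun x => (2 * h₁ (‖x - a‖ ^ 2)) • innerSL ℝ (x - a) :=
    funext fun x => (hasFDerivAt_radial hh a k x).fderiv
  have hD2 := (((hh₁ _).comp_hasFDerivAt x (hasFDerivAt_sq_norm_sub a x)).const_mul 2).smul
    ((innerSL ℝ).hasFDerivAt.comp x ((hasFDerivAt_id x).sub_const a))
  have hdir (v : Rd d) : iteratedFDeriv ℝ 2 (fun x => h (‖x - a‖ ^ 2) - k) x ![v, v]
      = 4 * h₂ (‖x - a‖ ^ 2) * inner ℝ (x - a) v ^ 2 + 2 * h₁ (‖x - a‖ ^ 2) * ‖v‖ ^ 2 := by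
    rw [iteratedFDeriv_two_apply, hD]
    erw [hD2.fderiv]
    change (2 * h₁ (‖x - a‖ ^ 2)) * inner ℝ v v
      + (2 * (h₂ (‖x - a‖ ^ 2) * (2 * inner ℝ (x - a) v))) * inner ℝ (x - a) v = _
    rw [real_inner_self_eq_norm_sq]
    ring
  rw [InnerProductSpace.laplacian_eq_iteratedFDeriv_orthonormalBasis _
    (EuclideanSpace.basisFun (Fin d) ℝ)]
  simp only [hdir, Finset.sum_add_distrib, ← Finset.mul_sum]
  have h1 := (EuclideanSpace.basisFun (Fin d) ℝ).sum_sq_norm_inner_left (x - a)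
  simp only [Real.norm_eq_abs, sq_abs] at h1
  rw [h1]
  simp
  ring

end Radial

/-! ### The concave truncation -/

/-- A smooth concave truncation of the identity of `[0, ∞)`: it equals `s` for `s ≤ R` and is
constant for `s ≥ 2 R`. -/
noncomputable def truncation (R s : ℝ) : ℝ := ∫ u in (0 : ℝ)..s, Real.smoothTransition (2 - u / R)

/-- The derivative of `truncation R`. -/
noncomputable def truncationDeriv (R s : ℝ) : ℝ := Real.smoothTransition (2 - s / R)

section Truncation

variable {R : ℝ}

theorem contDiff_truncationDeriv (R : ℝ) : ContDiff ℝ ∞ (truncationDeriv R) :=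
  Real.smoothTransition.contDiff.comp (contDiff_const.sub (contDiff_id.div_const R))

theorem hasDerivAt_truncation (R s : ℝ) : HasDerivAt (truncation R) (truncationDeriv R s) s :=
  (contDiff_truncationDeriv R).continuous.integral_hasStrictDerivAt 0 s |>.hasDerivAt

theorem contDiff_truncation (R : ℝ) : ContDiff ℝ ∞ (truncation R) := by
  rw [contDiff_infty_iff_deriv]
  refine ⟨fun s => (hasDerivAt_truncation R s).differentiableAt, ?_⟩
  rw [funext fun s => (hasDerivAt_truncation R s).deriv]
  exact contDiff_truncationDeriv R

theorem hasDerivAt_truncationDeriv (R s : ℝ) :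
    HasDerivAt (truncationDeriv R) (deriv (truncationDeriv R) s) s :=
  ((contDiff_truncationDeriv R).differentiable (by simp) s).hasDerivAt

theorem truncationDeriv_nonneg (R s : ℝ) : 0 ≤ truncationDeriv R s :=
  Real.smoothTransition.nonneg _

theorem truncationDeriv_le_one (R s : ℝ) : truncationDeriv R s ≤ 1 :=
  Real.smoothTransition.le_one _

theorem truncationDeriv_of_le (hR : 0 < R) {s : ℝ} (hs : s ≤ R) : truncationDeriv R s = 1 := by
  refine Real.smoothTransition.one_of_one_le ?_
  have := (div_le_one hR).2 hs
  linarith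

theorem truncationDeriv_of_ge (hR : 0 < R) {s : ℝ} (hs : 2 * R ≤ s) : truncationDeriv R s = 0 := by
  refine Real.smoothTransition.zero_of_nonpos ?_
  have := (le_div_iff₀ hR).2 hs
  linarith

theorem antitone_truncationDeriv (hR : 0 < R) : Antitone (truncationDeriv R) := fun _ _ hst =>
  Real.smoothTransition.monotone (sub_le_sub_left (div_le_div_of_nonneg_right hst hR.le) 2)

theorem deriv_truncationDeriv_nonpos (hR : 0 < R) (s : ℝ) : deriv (truncationDeriv R) s ≤ 0 :=
  (antitone_truncationDeriv hR).deriv_nonpos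

theorem monotone_truncation (R : ℝ) : Monotone (truncation R) :=
  monotone_of_hasDerivAt_nonneg (hasDerivAt_truncation R) (truncationDeriv_nonneg R)

theorem truncation_zero (R : ℝ) : truncation R 0 = 0 := by simp [truncation]

theorem truncation_nonneg {s : ℝ} (hs : 0 ≤ s) : 0 ≤ truncation R s :=
  (truncation_zero R).symm.trans_le (monotone_truncation R hs)

theorem truncation_le_self {s : ℝ} (hs : 0 ≤ s) : truncation R s ≤ s := by
  have h : Monotone fun s => s - truncation R s :=
    monotone_of_hasDerivAt_nonneg (fun s => (hasDerivAt_id s).sub (hasDerivAt_truncation R s))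
      fun s => sub_nonneg.2 (truncationDeriv_le_one R s)
  have := h hs
  simp only [truncation_zero, sub_self] at this
  linarith

theorem truncation_of_le (hR : 0 < R) {s : ℝ} (hs : s ≤ R) : truncation R s = s := by
  have : truncation R s = ∫ _u in (0 : ℝ)..s, (1 : ℝ) := by
    refine intervalIntegral.integral_congr fun u hu => ?_
    exact truncationDeriv_of_le hR (hu.2.trans (max_le hR.le hs))
  simpa using this

theorem truncation_of_ge (hR : 0 < R) {s : ℝ} (hs : 2 * R ≤ s) :
    truncation R s = truncation R (2 * R) := by
  refine (constant_of_has_deriv_right_zero (a := 2 * R) (b := s)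
    (fun u _ => (hasDerivAt_truncation R u).continuousAt.continuousWithinAt) (fun u hu => ?_) s
    (right_mem_Icc.2 hs))
  simpa [truncationDeriv_of_ge hR hu.1] using (hasDerivAt_truncation R u).hasDerivWithinAt

theorem truncation_le_two_mul (hR : 0 < R) (s : ℝ) : truncation R s ≤ 2 * R := by
  have h0 : (0 : ℝ) ≤ 2 * R := by positivity
  rcases le_total s (2 * R) with hs | hs
  · exact (monotone_truncation R hs).trans (truncation_le_self h0)
  · rw [truncation_of_ge hR hs]
    exact truncation_le_self h0

/-- The dissipation of one truncation controls any other truncation up to a small error. -/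
theorem truncation_sub_le {S : ℝ} (hR : 0 < R) (hS : 0 < S) {s : ℝ} (hs : 0 ≤ s) :
    truncation S s - 2 * S / R * truncation R s ≤ truncationDeriv R s * s := by
  -- Below `R` the right side is `s` itself. Above `R`, `truncation R s ≥ R`, so the subtracted term
  -- is at least `2 * S`, which dominates `truncation S s`.
  rcases le_total s R with h | h
  · rw [truncationDeriv_of_le hR h, one_mul]
    have h1 := truncation_le_self (R := S) hs
    have h2 := mul_nonneg (show 0 ≤ 2 * S / R by positivity) (truncation_nonneg (R := R) hs)
    linarith
  · have h1 := truncation_le_two_mul hS s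
    have h2 : R ≤ truncation R s :=
      (truncation_of_le hR le_rfl).symm.trans_le (monotone_truncation R h)
    have h3 := mul_le_mul_of_nonneg_left h2 (show 0 ≤ 2 * S / R by positivity)
    rw [div_mul_cancel₀ _ hR.ne'] at h3
    have h4 := mul_nonneg (truncationDeriv_nonneg R s) hs
    linarith

end Truncation

/-! ### Decay of second moments along weak solutions -/

section Main

variable {d : ℕ}

theorem contDiff_truncation_sq_norm (R : ℝ) (a : Rd d) :
    ContDiff ℝ ∞ fun x => truncation R (‖x - a‖ ^ 2) :=
  (contDiff_truncation R).comp ((contDiff_id.sub contDiff_const).norm_sq ℝ)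

theorem hasCompactSupport_of_forall_sq_norm {E : Type*} [Zero E] {f : Rd d → E} (a : Rd d) {M : ℝ}
    (hf : ∀ x, M ≤ ‖x - a‖ ^ 2 → f x = 0) : HasCompactSupport f := by
  refine HasCompactSupport.intro (isCompact_closedBall a (Real.sqrt (max M 0))) fun x hx => hf x ?_
  rw [Metric.mem_closedBall, not_le, dist_eq_norm] at hx
  exact (le_max_left _ _).trans ((Real.sqrt_lt_sqrt_iff_of_pos
    ((Real.sqrt_nonneg _).trans_lt hx |> fun h => by positivity)).1
    (by rwa [Real.sqrt_sq (norm_nonneg _)])).le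

theorem norm_truncation_le {R : ℝ} (hR : 0 < R) (a x : Rd d) :
    ‖truncation R (‖x - a‖ ^ 2)‖ ≤ 2 * R := by
  rw [Real.norm_of_nonneg (truncation_nonneg (sq_nonneg _))]
  exact truncation_le_two_mul hR _

theorem integrable_truncation {R : ℝ} (hR : 0 < R) (a : Rd d) (ν : ProbabilityMeasure (Rd d)) :
    Integrable (fun x => truncation R (‖x - a‖ ^ 2)) (ν : Measure (Rd d)) :=
  Integrable.of_bound (contDiff_truncation_sq_norm R a).continuous.aestronglyMeasurable (2 * R)
    (Eventually.of_forall fun x => norm_truncation_le hR a x)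

/-- A uniform bound on the truncated second moments bounds the second moment. -/
theorem lintegral_sq_norm_le_of_truncation {a : Rd d} {ν : ProbabilityMeasure (Rd d)} {M : ℝ}
    (h : ∀ R, 0 < R → ∫ x, truncation R (‖x - a‖ ^ 2) ∂(ν : Measure (Rd d)) ≤ M) :
    ∫⁻ x, ENNReal.ofReal (‖x - a‖ ^ 2) ∂(ν : Measure (Rd d)) ≤ ENNReal.ofReal M := by
  have hlim (x : Rd d) : Tendsto (fun n : ℕ => ENNReal.ofReal (truncation (n + 1) (‖x - a‖ ^ 2)))
      atTop (𝓝 (ENNReal.ofReal (‖x - a‖ ^ 2))) := by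
    refine tendsto_const_nhds.congr' ?_
    filter_upwards [eventually_ge_atTop ⌈‖x - a‖ ^ 2⌉₊] with n hn
    rw [truncation_of_le (by positivity) ((Nat.ceil_le.1 hn).trans (by linarith))]
  -- Fatou's lemma along the radii `n + 1`, shifted to stay positive.
  calc ∫⁻ x, ENNReal.ofReal (‖x - a‖ ^ 2) ∂(ν : Measure (Rd d))
      = ∫⁻ x, liminf (fun n : ℕ => ENNReal.ofReal (truncation (n + 1) (‖x - a‖ ^ 2))) atTop
          ∂(ν : Measure (Rd d)) := lintegral_congr fun x => (hlim x).liminf_eq.symm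
    _ ≤ liminf (fun n : ℕ => ∫⁻ x, ENNReal.ofReal (truncation (n + 1) (‖x - a‖ ^ 2))
          ∂(ν : Measure (Rd d))) atTop := lintegral_liminf_le fun n =>
        (contDiff_truncation_sq_norm _ a).continuous.measurable.ennreal_ofReal
    _ ≤ ENNReal.ofReal M := by
        refine liminf_le_of_frequently_le' (Frequently.of_forall fun n => ?_)
        rw [← ofReal_integral_eq_lintegral_ofReal (integrable_truncation (by positivity) a ν)
          (Eventually.of_forall fun x => truncation_nonneg (sq_nonneg _))]
        exact ENNReal.ofReal_le_ofReal (h _ (by positivity))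

theorem integral_truncation_le {a : Rd d} {ν : ProbabilityMeasure (Rd d)} {M : ℝ} (hM : 0 ≤ M)
    (h : ∫⁻ x, ENNReal.ofReal (‖x - a‖ ^ 2) ∂(ν : Measure (Rd d)) ≤ ENNReal.ofReal M) {R : ℝ}
    (hR : 0 < R) : ∫ x, truncation R (‖x - a‖ ^ 2) ∂(ν : Measure (Rd d)) ≤ M := by
  rw [← ENNReal.ofReal_le_ofReal_iff hM,
    ofReal_integral_eq_lintegral_ofReal (integrable_truncation hR a ν)
      (Eventually.of_forall fun x => truncation_nonneg (sq_nonneg _))]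
  exact (lintegral_mono fun x => ENNReal.ofReal_le_ofReal
    (truncation_le_self (sq_nonneg _))).trans h

/-- The Wasserstein distance to a Dirac measure is at most the root of the second moment. -/
theorem W2_diracProb_le (ν : ProbabilityMeasure (Rd d)) (a : Rd d) :
    W2 ν (diracProb a)
      ≤ (∫⁻ x, ENNReal.ofReal (‖x - a‖ ^ 2) ∂(ν : Measure (Rd d))) ^ (1 / 2 : ℝ) := by
  have hm : Measurable fun x : Rd d => (x, a) := measurable_id.prodMk measurable_const
  refine ENNReal.rpow_le_rpow ?_ (by norm_num)
  have hπ : IsCoupling ν (diracProb a) ((ν : Measure (Rd d)).map fun x => (x, a)) := by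
    refine ⟨?_, ?_⟩
    · rw [Measure.map_map measurable_fst hm]
      exact Measure.map_id
    · rw [Measure.map_map measurable_snd hm]
      change Measure.map (fun _ => a) _ = Measure.dirac a
      simp
  refine (iInf₂_le _ hπ).trans_eq ?_
  rw [lintegral_map (by fun_prop) hm]
  refine lintegral_congr fun x => ?_
  rw [edist_dist, dist_eq_norm, ENNReal.ofReal_pow (norm_nonneg _)]

variable {σ κ : ℝ} {V : Rd d → ℝ} {ρ : ℝ → ProbabilityMeasure (Rd d)}

theorem IsWeakSolution.continuousOn_integral_truncation (hρ : IsWeakSolution σ κ V ρ) {R : ℝ}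
    (hR : 0 < R) (a : Rd d) :
    ContinuousOn (fun t => ∫ x, truncation R (‖x - a‖ ^ 2) ∂(ρ t : Measure (Rd d))) (Ici 0) := by
  intro t ht
  exact (ProbabilityMeasure.tendsto_iff_forall_integral_tendsto.1 (hρ.continuousOn t ht))
    (BoundedContinuousFunction.ofNormedAddCommGroup _
      (contDiff_truncation_sq_norm R a).continuous (2 * R) (norm_truncation_le hR a))

/-- Dissipation of the truncated second moments along a weak solution, if the drift `x - p(x)`
is coercive and firmly nonexpansive with respect to `a`. -/
theorem IsWeakSolution.hasDerivAt_integral_truncation (hρ : IsWeakSolution σ κ V ρ)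
    (hσ : σ ^ 2 * d ≤ 1) (hcont : Continuous (prox κ V)) {a : Rd d} {C : ℝ} (hC : 0 < C)
    (hfirm : ∀ x, ‖x - prox κ V x‖ ^ 2 ≤ inner ℝ (x - a) (x - prox κ V x))
    (hcoer : ∀ x, ‖x - a‖ ^ 2 ≤ C * inner ℝ (x - a) (x - prox κ V x)) {R : ℝ} (hR : 0 < R)
    {t : ℝ} (ht : 0 < t) :
    ∃ D, HasDerivAt (fun t => ∫ x, truncation R (‖x - a‖ ^ 2) ∂(ρ t : Measure (Rd d))) D t ∧
      D ≤ -(C⁻¹ * ∫ x, truncationDeriv R (‖x - a‖ ^ 2) * ‖x - a‖ ^ 2 ∂(ρ t : Measure (Rd d))) := by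
  -- `k` is the value at infinity: subtracting it makes the test function compactly supported and
  -- shifts the integral by a constant.
  set k := truncation R (2 * R)
  let φ : Rd d → ℝ := fun x => truncation R (‖x - a‖ ^ 2) - k
  have hφ : ContDiff ℝ ∞ φ := (contDiff_truncation_sq_norm R a).sub contDiff_const
  have hsupp : HasCompactSupport φ := hasCompactSupport_of_forall_sq_norm a (M := 2 * R)
    fun x hx => by simp only [φ]; rw [truncation_of_ge hR hx, sub_self]
  have hder := hρ.hasDerivAt φ hφ hsupp t ht
  have hgrad := gradient_radial (hasDerivAt_truncation R) a k
  have hlap := laplacian_radial (hasDerivAt_truncation R) (hasDerivAt_truncationDeriv R) a k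
  have hint (s : ℝ) : ∫ x, truncation R (‖x - a‖ ^ 2) ∂(ρ s : Measure (Rd d))
      = (∫ x, φ x ∂(ρ s : Measure (Rd d))) + k := by
    simp only [φ]
    rw [integral_sub (integrable_truncation hR a _) (integrable_const _)]
    simp
  have hc1 : Continuous fun x : Rd d => truncationDeriv R (‖x - a‖ ^ 2) :=
    (contDiff_truncationDeriv R).continuous.comp (by fun_prop)
  have hc2 : Continuous fun x : Rd d => deriv (truncationDeriv R) (‖x - a‖ ^ 2) :=
    ((contDiff_truncationDeriv R).continuous_deriv (by simp)).comp (by fun_prop)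
  have hzero {x : Rd d} (hx : 2 * R ≤ ‖x - a‖ ^ 2) : truncationDeriv R (‖x - a‖ ^ 2) = 0 :=
    truncationDeriv_of_ge hR hx
  -- The bound `3 * R` leaves room beyond `2 * R` for `truncationDeriv R` to vanish on a
  -- neighbourhood.
  have hzero2 {x : Rd d} (hx : 3 * R ≤ ‖x - a‖ ^ 2) :
      deriv (truncationDeriv R) (‖x - a‖ ^ 2) = 0 := by
    refine (Filter.EventuallyEq.deriv_eq (f := fun _ => (0 : ℝ)) ?_).trans (deriv_const _ _)
    filter_upwards [eventually_gt_nhds (show 2 * R < ‖x - a‖ ^ 2 by linarith)] with s hs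
    exact truncationDeriv_of_ge hR hs.le
  have hi1 : Integrable (fun x => inner ℝ (gradient φ x) (x - prox κ V x))
      (ρ t : Measure (Rd d)) := by
    simp only [φ, hgrad]
    refine Continuous.integrable_of_hasCompactSupport (by fun_prop)
      (hasCompactSupport_of_forall_sq_norm a (M := 2 * R) fun x hx => ?_)
    simp [hzero hx]
  have hi2 : Integrable (fun x => Laplacian.laplacian φ x * ‖x - prox κ V x‖ ^ 2)
      (ρ t : Measure (Rd d)) := by
    simp only [φ, hlap]
    refine Continuous.integrable_of_hasCompactSupport (by fun_prop)
      (hasCompactSupport_of_forall_sq_norm a (M := 3 * R) fun x hx => ?_)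
    simp [hzero2 hx, hzero (show 2 * R ≤ ‖x - a‖ ^ 2 by linarith)]
  have hi3 : Integrable (fun x => truncationDeriv R (‖x - a‖ ^ 2) * ‖x - a‖ ^ 2)
      (ρ t : Measure (Rd d)) := by
    refine Continuous.integrable_of_hasCompactSupport (by fun_prop)
      (hasCompactSupport_of_forall_sq_norm a (M := 2 * R) fun x hx => ?_)
    simp [hzero hx]
  refine ⟨_, (hder.add_const k).congr_of_eventuallyEq (Eventually.of_forall hint), ?_⟩
  rw [← integral_neg, ← integral_const_mul, ← integral_const_mul, ← integral_neg,
    ← integral_add hi1.fun_neg (hi2.const_mul _)]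
  refine integral_mono (hi1.fun_neg.fun_add (hi2.const_mul _)) (hi3.const_mul _).fun_neg fun x => ?_
  simp only [φ, hgrad, hlap, inner_smul_left, conj_trivial]
  set g := truncationDeriv R (‖x - a‖ ^ 2)
  set I := inner ℝ (x - a) (x - prox κ V x)
  set B := ‖x - prox κ V x‖ ^ 2
  have hg : 0 ≤ g := truncationDeriv_nonneg _ _
  have hB : 0 ≤ B := sq_nonneg _
  have h2 : deriv (truncationDeriv R) (‖x - a‖ ^ 2) ≤ 0 := deriv_truncationDeriv_nonpos hR _
  -- Concavity: the second-derivative part of the Laplacian only increases the dissipation and is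
  -- dropped.
  have h3 : 0 ≤ σ ^ 2 / 2 * (4 * -deriv (truncationDeriv R) (‖x - a‖ ^ 2) * ‖x - a‖ ^ 2 * B) :=
    mul_nonneg (by positivity) (mul_nonneg (mul_nonneg (by linarith) (sq_nonneg _)) hB)
  -- One of the two copies of `g * I` in the drift pays for the noise; the other remains for `h5`.
  have h4 : σ ^ 2 * d * (g * B) ≤ g * I :=
    (mul_le_of_le_one_left (mul_nonneg hg hB) hσ).trans (mul_le_mul_of_nonneg_left (hfirm x) hg)
  have h5 : C⁻¹ * (g * ‖x - a‖ ^ 2) ≤ g * I := by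
    rw [inv_mul_le_iff₀ hC]
    calc g * ‖x - a‖ ^ 2 ≤ g * (C * I) := mul_le_mul_of_nonneg_left (hcoer x) hg
      _ = C * (g * I) := by ring
  linarith

/-- Decay of the truncated second moments along a weak solution. -/
theorem IsWeakSolution.integral_truncation_decay (hρ : IsWeakSolution σ κ V ρ)
    (hσ : σ ^ 2 * d ≤ 1) (hcont : Continuous (prox κ V)) {a : Rd d} {C : ℝ} (hC : 0 < C)
    (hfirm : ∀ x, ‖x - prox κ V x‖ ^ 2 ≤ inner ℝ (x - a) (x - prox κ V x))
    (hcoer : ∀ x, ‖x - a‖ ^ 2 ≤ C * inner ℝ (x - a) (x - prox κ V x)) {M : ℝ}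
    (hM : ∀ R, 0 < R → ∫ x, truncation R (‖x - a‖ ^ 2) ∂(ρ 0 : Measure (Rd d)) ≤ M)
    {S : ℝ} (hS : 0 < S) {T : ℝ} (hT : 0 < T) :
    ∫ x, truncation S (‖x - a‖ ^ 2) ∂(ρ T : Measure (Rd d)) ≤ C * M / T := by
  set I : ℝ → ℝ → ℝ := fun R t => ∫ x, truncation R (‖x - a‖ ^ 2) ∂(ρ t : Measure (Rd d)) with hI
  have hder {R : ℝ} (hR : 0 < R) {t : ℝ} (ht : 0 < t) :=
    hρ.hasDerivAt_integral_truncation hσ hcont hC hfirm hcoer hR ht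
  have hanti {R : ℝ} (hR : 0 < R) : AntitoneOn (I R) (Ici 0) := by
    refine antitoneOn_of_deriv_nonpos (convex_Ici 0) (hρ.continuousOn_integral_truncation hR a)
      (fun t ht => ?_) fun t ht => ?_ <;> rw [interior_Ici] at ht
    · obtain ⟨D, hD, -⟩ := hder hR ht
      exact hD.differentiableAt.differentiableWithinAt
    · obtain ⟨D, hD, hle⟩ := hder hR ht
      rw [hD.deriv]
      refine hle.trans (neg_nonpos.2 (mul_nonneg (inv_nonneg.2 hC.le) (integral_nonneg fun x =>
        mul_nonneg (truncationDeriv_nonneg _ _) (sq_nonneg _))))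
  have hM0 : 0 ≤ M := (integral_nonneg fun x => truncation_nonneg (sq_nonneg _)).trans
    (hM 1 one_pos)
  have hIM {R : ℝ} (hR : 0 < R) {t : ℝ} (ht : 0 ≤ t) : I R t ≤ M :=
    (hanti hR self_mem_Ici ht ht).trans (hM R hR)
  have hkey {R : ℝ} (hR : 0 < R) : I S T ≤ C * M / T + 2 * S / R * M := by
    -- The mean value inequality on `[0, T]`: as `I S` is nonincreasing, `I S T` bounds `I S t`
    -- below and the dissipation rate is uniform in `t`.
    have hdec : I R T - I R 0 ≤ -(C⁻¹ * (I S T - 2 * S / R * M)) * (T - 0) := by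
      refine (convex_Icc 0 T).image_sub_le_mul_sub_of_deriv_le
        ((hρ.continuousOn_integral_truncation hR a).mono Icc_subset_Ici_self)
        (fun t ht => ?_) (fun t ht => ?_) 0 (left_mem_Icc.2 hT.le) T (right_mem_Icc.2 hT.le) hT.le
        <;> rw [interior_Icc] at ht
      · obtain ⟨D, hD, -⟩ := hder hR ht.1
        exact hD.differentiableAt.differentiableWithinAt
      · obtain ⟨D, hD, hle⟩ := hder hR ht.1
        rw [hD.deriv]
        refine hle.trans (neg_le_neg (mul_le_mul_of_nonneg_left ?_ (inv_nonneg.2 hC.le)))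
        have h1 : I S T ≤ I S t := hanti hS ht.1.le hT.le ht.2.le
        have h2 : 2 * S / R * I R t ≤ 2 * S / R * M :=
          mul_le_mul_of_nonneg_left (hIM hR ht.1.le) (by positivity)
        have h3 : I S t - 2 * S / R * I R t
            ≤ ∫ x, truncationDeriv R (‖x - a‖ ^ 2) * ‖x - a‖ ^ 2 ∂(ρ t : Measure (Rd d)) := by
          simp only [hI]
          rw [← integral_const_mul, ← integral_sub (integrable_truncation hS a _)
            ((integrable_truncation hR a _).const_mul _)]
          refine integral_mono ((integrable_truncation hS a _).sub
            ((integrable_truncation hR a _).const_mul _)) ?_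
            fun x => truncation_sub_le hR hS (sq_nonneg _)
          refine Continuous.integrable_of_hasCompactSupport
            (((contDiff_truncationDeriv R).continuous.comp (by fun_prop)).mul (by fun_prop))
            (hasCompactSupport_of_forall_sq_norm a (M := 2 * R) fun x hx => ?_)
          simp [truncationDeriv_of_ge hR hx]
        linarith
    have h0 : 0 ≤ I R T := integral_nonneg fun x => truncation_nonneg (sq_nonneg _)
    have h1 : C⁻¹ * ((I S T - 2 * S / R * M) * T) ≤ M := by
      have := hM R hR
      linarith
    rw [inv_mul_le_iff₀ hC, ← le_div_iff₀ hT] at h1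
    linarith
  -- With `S` fixed, the truncation error vanishes as `R → ∞`.
  have hlim : Tendsto (fun R : ℝ => C * M / T + 2 * S / R * M) atTop (𝓝 (C * M / T + 0 * M)) :=
    ((tendsto_const_nhds.div_atTop tendsto_id).mul_const M).const_add _
  rw [zero_mul, add_zero] at hlim
  refine ge_of_tendsto hlim ?_
  filter_upwards [eventually_gt_atTop 0] with R hR using hkey hR

end Main

/-! ### Initial moment and conclusion -/

/-- A finite Lyapunov functional gives a finite second moment. -/
theorem lintegral_sq_norm_lt_top_of_lyapunov {d : ℕ} {κ : ℝ} {V : Rd d → ℝ}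
    {ν : ProbabilityMeasure (Rd d)} {a : Rd d} {C : ℝ} (hC : 0 < C)
    (hcoer : ∀ x, ‖x - a‖ ^ 2 ≤ C * inner ℝ (x - a) (x - prox κ V x))
    (hν : lyapunov κ V ν < ⊤) :
    ∫⁻ x, ENNReal.ofReal (‖x - a‖ ^ 2) ∂(ν : Measure (Rd d)) < ⊤ := by
  have hle (x : Rd d) : ENNReal.ofReal (‖x - a‖ ^ 2)
      ≤ ENNReal.ofReal (C ^ 2) * ‖x - prox κ V x‖ₑ ^ 2 := by
    rw [← ofReal_norm, ← ENNReal.ofReal_pow (norm_nonneg _),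
      ← ENNReal.ofReal_mul (sq_nonneg C), ← mul_pow]
    refine ENNReal.ofReal_le_ofReal (pow_le_pow_left₀ (norm_nonneg _) ?_ 2)
    have h1 := hcoer x
    have h2 := mul_le_mul_of_nonneg_left (real_inner_le_norm (x - a) (x - prox κ V x)) hC.le
    -- Cauchy–Schwarz in the coercivity bound, then cancel one factor `‖x - a‖`.
    rcases (norm_nonneg (x - a)).eq_or_lt with h0 | h0
    · rw [← h0]; positivity
    · refine le_of_mul_le_mul_left ?_ h0
      nlinarith
  refine (lintegral_mono hle).trans_lt ?_
  rw [lintegral_const_mul' _ _ ENNReal.ofReal_ne_top]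
  refine ENNReal.mul_lt_top ENNReal.ofReal_lt_top ?_
  rw [lyapunov] at hν
  by_contra htop
  rw [not_lt, top_le_iff] at htop
  rw [htop, ENNReal.mul_top (by simp)] at hν
  exact lt_irrefl _ hν

theorem mainTheorem1 (d : ℕ) (κ : ℝ) (hκ : 0 < κ) (V : Rd d → ℝ) (hV : ContDiff ℝ 2 V)
    (μ L : ℝ) (hμ : 0 < μ) (hμL : μ ≤ L)
    (hlower : ∀ x v : Rd d, μ * ‖v‖ ^ 2 ≤ iteratedFDeriv ℝ 2 V x ![v, v])
    (hupper : ∀ x v : Rd d, iteratedFDeriv ℝ 2 V x ![v, v] ≤ L * ‖v‖ ^ 2) :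
    (∀ y, y ≠ argmin V → V (argmin V) < V y) ∧
    ∃ C₁ : ℝ, 0 < C₁ ∧ ∀ σ : ℝ, 0 ≤ σ → σ < C₁ →
      (0 < σ → ContDiff ℝ 3 V ∧
        BddAbove (Set.range fun x : Rd d => ‖fderiv ℝ V x‖ * ‖iteratedFDeriv ℝ 3 V x‖)) →
      ∀ ρ : ℝ → ProbabilityMeasure (Rd d), IsWeakSolution σ κ V ρ →
        lyapunov κ V (ρ 0) < ⊤ →
        Tendsto (fun t => W2 (ρ t) (diracProb (argmin V))) atTop (𝓝 0) := by
  have hdiff : Differentiable ℝ V := hV.differentiable (by norm_num)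
  have hmono := fderiv_strongly_monotone hV hlower
  have hmin := exists_strict_minimizer hμ hdiff hmono
  -- From `σ * (d + 1) < 1` both `σ ≤ 1` and `σ * d ≤ 1` follow, hence `σ ^ 2 * d ≤ 1`; the `+ 1`
  -- also covers `d = 0`.
  refine ⟨strict_argmin hmin, 1 / (d + 1), by positivity, fun σ hσ0 hσ1 _ ρ hρ hlyap => ?_⟩
  have hσ : σ ^ 2 * d ≤ 1 := by
    rw [lt_div_iff₀ (by positivity)] at hσ1
    nlinarith [mul_nonneg hσ0 d.cast_nonneg (α := ℝ)]
  set C := 2 / (κ ^ 2 * μ) + 2 with hCdef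
  have hC : 0 < C := by positivity
  have hcoer := sq_norm_sub_argmin_le hκ hμ hdiff hmono hmin
  have hfin := lintegral_sq_norm_lt_top_of_lyapunov hC hcoer hlyap
  set M := (∫⁻ x, ENNReal.ofReal (‖x - argmin V‖ ^ 2) ∂(ρ 0 : Measure (Rd d))).toReal
  have hM (R : ℝ) (hR : 0 < R) := integral_truncation_le (M := M) ENNReal.toReal_nonneg
    (ENNReal.ofReal_toReal hfin.ne).ge hR
  have hbound {T : ℝ} (hT : 0 < T) :
      W2 (ρ T) (diracProb (argmin V)) ≤ ENNReal.ofReal (C * M / T) ^ (1 / 2 : ℝ) :=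
    (W2_diracProb_le _ _).trans (ENNReal.rpow_le_rpow (lintegral_sq_norm_le_of_truncation
      fun S hS => hρ.integral_truncation_decay hσ (lipschitzWith_prox hκ hμ hdiff hmono).continuous
        hC (sq_norm_sub_prox_le hκ hμ hdiff hmono hmin) hcoer hM hS hT) (by norm_num))
  have hlim : Tendsto (fun T : ℝ => ENNReal.ofReal (C * M / T) ^ (1 / 2 : ℝ)) atTop (𝓝 0) := by
    have h1 : Tendsto (fun T : ℝ => C * M / T) atTop (𝓝 0) :=
      tendsto_const_nhds.div_atTop tendsto_id
    have h2 := ((ENNReal.continuous_rpow_const (y := 1 / 2)).tendsto _).comp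
      (ENNReal.tendsto_ofReal h1)
    rwa [ENNReal.ofReal_zero, ENNReal.zero_rpow_of_pos (by norm_num)] at h2
  refine tendsto_of_tendsto_of_tendsto_of_le_of_le' tendsto_const_nhds hlim
    (Eventually.of_forall fun _ => zero_le) ?_
  filter_upwards [eventually_gt_atTop 0] with T hT using hbound hT
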